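/- Let $M$ be a smooth (real, finite-dimensional, Hausdorff) manifold; all tensor fields below are smooth. For a bivector field $\pi$ let $\pi^\sharp:T^*M\to TM$ be defined by $\langle b,\pi^\sharp a\rangle=\pi(a,b)$, and let $\{f,g\}=\pi(df,dg)=\langle dg,\pi^\sharp df\rangle$. For a $(1,1)$ tensor field $N:TM\to TM$ with transpose $N^*:T^*M\to T^*M$ put $$T_N(X,Y)=[NX,NY]-N\big([NX,Y]+[X,NY]-N[X,Y]\big),\qquad (i_N\omega)(X_1,\dots,X_p)=\sum_{i=1}^p\omega(X_1,\dots,NX_i,\dots,X_p)$$ for vector fields $X,Y,X_1,\dots,X_p$ and $p$-forms $\omega$. A quadruple $(M,\pi,N,\phi)$, with $\pi$ a bivector field, $N$ a $(1,1)$ tensor field and $\phi$ a 3-form, is a *Poisson quasi-Nijenhuis (PqN) manifold* if 1. $\pi$ is a Poisson bivector, that is, $\{\cdot,\cdot\}$ satisfies the Jacobi identity on smooth functions; 2. $\pi$ and $N$ are compatible: $N\pi^\sharp=\pi^\sharp N^*$, and $L_{\pi^\sharp a}(N)X-\pi^\sharp L_X(N^*a)+\pi^\sharp L_{NX}a=0$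 for all 1-forms $a$ and vector fields $X$, where $L$ is the Lie derivative; 3. $d\phi=0$ and $d(i_N\phi)=0$; 4. $T_N(X,Y)=\pi^\sharp(i_{X\wedge Y}\phi)$ for all vector fields $X,Y$, where $\langle i_{X\wedge Y}\phi,Z\rangle=\phi(X,Y,Z)$. For $k\ge1$ let $H_k=\frac1{2k}\operatorname{Tr}(N^k)$. **Theorem.** Let $(M,\pi,N,\phi)$ be a PqN manifold such that $\phi=\alpha\wedge\beta\wedge\gamma$, where $\alpha=dH_1$ and $\beta,\gamma$ are 1-forms. Then $(M,\pi,N,\phi)$ is involutive, that is, $$\{H_l,H_m\}=0\qquad\text{for all } l,m\ge1.$$ -/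

import Mathlib

open scoped Manifold ContDiff Bundle

noncomputable section

namespace PqN

variable {E : Type*} [NormedAddCommGroup E] [NormedSpace ℝ E]
  {M : Type*} [TopologicalSpace M] [ChartedSpace E M]

/-! ### Tensor fields on a manifold `M` modelled on `E`

Fields are pointwise families; smoothness is a separate predicate. -/

variable (E M) in
/-- Vector fields. -/
abbrev VField := ∀ x : M, TangentSpace 𝓘(ℝ, E) x

variable (E M) in
/-- Fields of covectors. -/
abbrev OneForm := ∀ x : M, TangentSpace 𝓘(ℝ, E) x →L[ℝ] ℝ

variable (E M) in
/-- Fields of alternating `p`-linear forms. -/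
abbrev Form (p : ℕ) := ∀ x : M, TangentSpace 𝓘(ℝ, E) x [⋀^Fin p]→L[ℝ] ℝ

variable (E M) in
/-- `(1,1)` tensor fields, as fields of endomorphisms of the tangent spaces. -/
abbrev EndField := ∀ x : M, TangentSpace 𝓘(ℝ, E) x →L[ℝ] TangentSpace 𝓘(ℝ, E) x

variable (E M) in
/-- Contravariant 2-tensor fields `π`, given by their sharp map `P = π♯ : T*M → TM`,
where `⟨β, π♯ α⟩ = π(α, β)`. -/
abbrev SharpField :=
  ∀ x : M, (TangentSpace 𝓘(ℝ, E) x →L[ℝ] ℝ) →L[ℝ] TangentSpace 𝓘(ℝ, E) x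

/-- `X` is a smooth vector field. -/
def VField.Smooth [IsManifold 𝓘(ℝ, E) ∞ M] (X : VField E M) : Prop :=
  ContMDiff 𝓘(ℝ, E) 𝓘(ℝ, E).tangent ∞ (fun x : M => (⟨x, X x⟩ : TangentBundle 𝓘(ℝ, E) M))

/-- `α` is a smooth section of the cotangent bundle. -/
def OneForm.Smooth [IsManifold 𝓘(ℝ, E) ∞ M] (α : OneForm E M) : Prop :=
  ContMDiff 𝓘(ℝ, E) (𝓘(ℝ, E).prod 𝓘(ℝ, E →L[ℝ] ℝ)) ∞
    (fun x : M => Bundle.TotalSpace.mk' (E →L[ℝ] ℝ)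
      (E := fun x : M => TangentSpace 𝓘(ℝ, E) x →L[ℝ] Bundle.Trivial M ℝ x) x (α x))

/-- `N` is a smooth section of the endomorphism bundle of the tangent bundle. -/
def EndField.Smooth [IsManifold 𝓘(ℝ, E) ∞ M] (N : EndField E M) : Prop :=
  ContMDiff 𝓘(ℝ, E) (𝓘(ℝ, E).prod 𝓘(ℝ, E →L[ℝ] E)) ∞
    (fun x : M => Bundle.TotalSpace.mk' (E →L[ℝ] E)
      (E := fun x : M => TangentSpace 𝓘(ℝ, E) x →L[ℝ] TangentSpace 𝓘(ℝ, E) x) x (N x))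

/-- `π♯` is a smooth section of the bundle of homomorphisms from `T*M` to `TM`. -/
def SharpField.Smooth [IsManifold 𝓘(ℝ, E) ∞ M] (P : SharpField E M) : Prop :=
  ContMDiff 𝓘(ℝ, E) (𝓘(ℝ, E).prod 𝓘(ℝ, (E →L[ℝ] ℝ) →L[ℝ] E)) ∞
    (fun x : M => Bundle.TotalSpace.mk' ((E →L[ℝ] ℝ) →L[ℝ] E)
      (E := fun x : M => (TangentSpace 𝓘(ℝ, E) x →L[ℝ] Bundle.Trivial M ℝ x) →L[ℝ]
        TangentSpace 𝓘(ℝ, E) x) x (P x))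

/-- The differential of a function, as a 1-form. -/
abbrev dfun (f : M → ℝ) : OneForm E M := fun x => mvfderiv 𝓘(ℝ, E) f x

/-! ### Local expressions in the chart at a point -/

/-- The expression of a vector field in the chart at `x`. -/
def VField.inChart (X : VField E M) (x : M) : E → E := fun y =>
  VectorField.mpullback 𝓘(ℝ, E) 𝓘(ℝ, E) (extChartAt 𝓘(ℝ, E) x).symm X y

/-- The expression of a 1-form in the chart at `x`. -/
def OneForm.inChart (α : OneForm E M) (x : M) : E → (E →L[ℝ] ℝ) := fun y =>
  (α ((extChartAt 𝓘(ℝ, E) x).symm y)).comp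
    (mfderiv 𝓘(ℝ, E) 𝓘(ℝ, E) (extChartAt 𝓘(ℝ, E) x).symm y)

/-- The expression of a `p`-form in the chart at `x`. -/
def Form.inChart {p : ℕ} (η : Form E M p) (x : M) : E → E [⋀^Fin p]→L[ℝ] ℝ := fun y =>
  (η ((extChartAt 𝓘(ℝ, E) x).symm y)).compContinuousLinearMap
    (mfderiv 𝓘(ℝ, E) 𝓘(ℝ, E) (extChartAt 𝓘(ℝ, E) x).symm y)

/-- A `p`-form is smooth if its expressions in the charts are smooth. -/
def Form.Smooth {p : ℕ} (η : Form E M p) : Prop :=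
  ∀ x : M, ContDiffOn ℝ ∞ (Form.inChart η x) (extChartAt 𝓘(ℝ, E) x).target

/-- The exterior derivative of a `p`-form. -/
def Form.d {p : ℕ} (η : Form E M p) : Form E M (p + 1) := fun x =>
  (extDeriv (Form.inChart η x) (extChartAt 𝓘(ℝ, E) x x)).compContinuousLinearMap
    (mfderiv 𝓘(ℝ, E) 𝓘(ℝ, E) (extChartAt 𝓘(ℝ, E) x) x)

/-- The Lie derivative `L_X α` of a 1-form: in coordinates
`(L_X α)_j = X^i ∂_i α_j + α_i ∂_j X^i`. -/
def lieOneForm (X : VField E M) (α : OneForm E M) : OneForm E M := fun x =>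
  (fderiv ℝ (OneForm.inChart α x) (extChartAt 𝓘(ℝ, E) x x)
      (VField.inChart X x (extChartAt 𝓘(ℝ, E) x x)) +
    (OneForm.inChart α x (extChartAt 𝓘(ℝ, E) x x)).comp
      (fderiv ℝ (VField.inChart X x) (extChartAt 𝓘(ℝ, E) x x))).comp
    (mfderiv 𝓘(ℝ, E) 𝓘(ℝ, E) (extChartAt 𝓘(ℝ, E) x) x)

/-! ### Algebraic operations -/

/-- The vector field `N X`. -/
def EndField.app (N : EndField E M) (X : VField E M) : VField E M := fun x => N x (X x)

/-- The 1-form `N* α`. -/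
def EndField.transpose (N : EndField E M) (α : OneForm E M) : OneForm E M :=
  fun x => (α x).comp (N x)

/-- The vector field `π♯ α`. -/
def SharpField.app (P : SharpField E M) (α : OneForm E M) : VField E M := fun x => P x (α x)

/-- `i_A η (v₁, …, v_p) = ∑ i, η (v₁, …, A v_i, …, v_p)` on a single vector space. -/
def contractEnd {V : Type*} [AddCommGroup V] [Module ℝ V] [TopologicalSpace V] {p : ℕ}
    (A : V →L[ℝ] V) (η : V [⋀^Fin p]→L[ℝ] ℝ) : V [⋀^Fin p]→L[ℝ] ℝ where
  toFun v := ∑ i, η (Function.update v i (A (v i)))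
  map_update_add' := by
    intro _ v j a b
    obtain rfl : ‹DecidableEq (Fin p)› = instDecidableEqFin p := Subsingleton.elim _ _
    rw [← Finset.sum_add_distrib]
    refine Finset.sum_congr rfl fun i _ => ?_
    by_cases h : i = j
    · subst h; simp
    · simp [Function.update_of_ne h, Function.update_comm (Ne.symm h)]
  map_update_smul' := by
    intro _ v j c a
    obtain rfl : ‹DecidableEq (Fin p)› = instDecidableEqFin p := Subsingleton.elim _ _
    rw [Finset.smul_sum]
    refine Finset.sum_congr rfl fun i _ => ?_
    by_cases h : i = j
    · subst h; simp
    · simp [Function.update_of_ne h, Function.update_comm (Ne.symm h)]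
  cont := by
    refine continuous_finsetSum _ fun i _ => η.cont.comp ?_
    exact continuous_id.update i (A.continuous.comp (continuous_apply i))
  map_eq_zero_of_eq' := by
    intro v a b hv hab
    have hsum : ∑ i, η (Function.update v i (A (v i))) =
        η (Function.update v a (A (v a))) + η (Function.update v b (A (v b))) := by
      refine Finset.sum_eq_add a b hab (fun i _ hi => ?_) (by simp) (by simp)
      refine η.map_eq_zero_of_eq _ ?_ hab
      rw [Function.update_of_ne hi.1.symm, Function.update_of_ne hi.2.symm, hv]
    have hswap : Function.update v b (A (v b)) =
        (Function.update v a (A (v a))) ∘ Equiv.swap a b := by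
      funext i
      by_cases h1 : i = a
      · subst h1; simp [hab, hab.symm, hv]
      · by_cases h2 : i = b
        · subst h2; simp [hv]
        · simp [h1, h2, Equiv.swap_apply_of_ne_of_ne h1 h2]
    change ∑ i, η (Function.update v i (A (v i))) = 0
    rw [hsum, hswap]
    exact η.toAlternatingMap.map_add_swap _ hab

/-- `i_N η`. -/
def EndField.contract {p : ℕ} (N : EndField E M) (η : Form E M p) : Form E M p :=
  fun x => contractEnd (N x) (η x)

/-- The 1-form `i_{X ∧ Y} φ = φ(X, Y, ·)` of a 3-form `φ`. -/
def Form.contractPair (φ : Form E M 3) (X Y : VField E M) : OneForm E M := fun x =>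
  (φ x).toContinuousLinearMap ![X x, Y x, 0] 2

/-- The wedge product of three covectors,
`(a ∧ b ∧ c)(v₁, v₂, v₃) = det [[a v₁, b v₁, c v₁], [a v₂, b v₂, c v₂], [a v₃, b v₃, c v₃]]`. -/
def wedgeCovectors {V : Type*} [AddCommGroup V] [Module ℝ V] [TopologicalSpace V]
    (a b c : V →L[ℝ] ℝ) : V [⋀^Fin 3]→L[ℝ] ℝ where
  toAlternatingMap := (Matrix.detRowAlternating (R := ℝ) (n := Fin 3)).compLinearMap
    (LinearMap.pi ![a.toLinearMap, b.toLinearMap, c.toLinearMap])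
  cont := by
    have key : ∀ j : Fin 3, Continuous fun v : V =>
        ((![a.toLinearMap, b.toLinearMap, c.toLinearMap] : Fin 3 → V →ₗ[ℝ] ℝ) j) v := by
      intro j
      fin_cases j
      · exact a.continuous
      · exact b.continuous
      · exact c.continuous
    change Continuous fun v : Fin 3 → V => Matrix.det (fun i j : Fin 3 =>
      ((![a.toLinearMap, b.toLinearMap, c.toLinearMap] : Fin 3 → V →ₗ[ℝ] ℝ) j) (v i))
    refine Continuous.matrix_det ?_
    exact continuous_pi fun i => continuous_pi fun j => (key j).comp (continuous_apply i)

/-- The 3-form `α ∧ β ∧ γ`. -/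
def OneForm.wedge₃ (α β γ : OneForm E M) : Form E M 3 :=
  fun x => wedgeCovectors (α x) (β x) (γ x)

/-! ### Poisson quasi-Nijenhuis structures -/

/-- The bracket `{f, g} = π(df, dg) = ⟨dg, π♯ df⟩`. -/
def SharpField.bracket (P : SharpField E M) (f g : M → ℝ) : M → ℝ :=
  fun x => dfun (E := E) g x (P x (dfun f x))

/-- The Nijenhuis torsion `T_N(X,Y) = [NX,NY] - N([NX,Y] + [X,NY] - N[X,Y])`. -/
def EndField.torsion (N : EndField E M) (X Y : VField E M) : VField E M := fun x =>
  VectorField.mlieBracket 𝓘(ℝ, E) (N.app X) (N.app Y) x -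
    N x (VectorField.mlieBracket 𝓘(ℝ, E) (N.app X) Y x +
      VectorField.mlieBracket 𝓘(ℝ, E) X (N.app Y) x -
      N x (VectorField.mlieBracket 𝓘(ℝ, E) X Y x))

/-- The Lie derivative of a `(1,1)` tensor field, `L_Z(N) X = [Z, NX] - N[Z, X]`. -/
def lieEnd (Z : VField E M) (N : EndField E M) (X : VField E M) : VField E M := fun x =>
  VectorField.mlieBracket 𝓘(ℝ, E) Z (N.app X) x - N x (VectorField.mlieBracket 𝓘(ℝ, E) Z X x)

/-- `π`, given by `P = π♯`, is a Poisson bivector field: smooth, skew-symmetric, and its bracket on smooth functions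
satisfies the Jacobi identity. -/
structure IsPoisson [IsManifold 𝓘(ℝ, E) ∞ M] (P : SharpField E M) : Prop where
  smooth : P.Smooth
  skew : ∀ (x : M) (a b : TangentSpace 𝓘(ℝ, E) x →L[ℝ] ℝ), b (P x a) = -a (P x b)
  jacobi : ∀ f g h : M → ℝ, ContMDiff 𝓘(ℝ, E) 𝓘(ℝ, ℝ) ∞ f → ContMDiff 𝓘(ℝ, E) 𝓘(ℝ, ℝ) ∞ g →
    ContMDiff 𝓘(ℝ, E) 𝓘(ℝ, ℝ) ∞ h → ∀ x : M,
    P.bracket (P.bracket f g) h x + P.bracket (P.bracket g h) f x +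
      P.bracket (P.bracket h f) g x = 0

/-- Compatibility of `π` and `N`: `N π♯ = π♯ N*` and
`L_{π♯ α}(N) X - π♯ L_X (N* α) + π♯ L_{NX} α = 0` for all 1-forms `α` and vector fields `X`. -/
structure IsCompatible [IsManifold 𝓘(ℝ, E) ∞ M] (P : SharpField E M) (N : EndField E M) :
    Prop where
  comm : ∀ (x : M) (a : TangentSpace 𝓘(ℝ, E) x →L[ℝ] ℝ), N x (P x a) = P x (a.comp (N x))
  lie : ∀ (α : OneForm E M) (X : VField E M), α.Smooth → X.Smooth → ∀ x : M,
    lieEnd (P.app α) N X x - P x (lieOneForm X (N.transpose α) x) +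
      P x (lieOneForm (N.app X) α x) = 0

/-- `(M, π, N, φ)` is a Poisson quasi-Nijenhuis manifold. -/
structure IsPoissonQuasiNijenhuis [IsManifold 𝓘(ℝ, E) ∞ M]
    (P : SharpField E M) (N : EndField E M) (φ : Form E M 3) : Prop where
  poisson : IsPoisson P
  smooth_N : N.Smooth
  smooth_phi : φ.Smooth
  compatible : IsCompatible P N
  closed : Form.d φ = 0
  closed_contract : Form.d (N.contract φ) = 0
  torsion_eq : ∀ X Y : VField E M, X.Smooth → Y.Smooth → ∀ x : M,
    N.torsion X Y x = P x (φ.contractPair X Y x)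

/-- The functions `H_k = (1 / 2k) Tr (N ^ k)` (meaningful for `k ≥ 1`). -/
def EndField.H (N : EndField E M) (k : ℕ) : M → ℝ := fun x =>
  1 / (2 * (k : ℝ)) * LinearMap.trace ℝ (TangentSpace 𝓘(ℝ, E) x) ((N x).toLinearMap ^ k)

end PqN

end

/-! Differentiating traces gives, for any `N`, the recursion `dH_{k+2} = N* dH_{k+1} - ½ Tr(N^k
T_N(v, ·))` (`EndField.Smooth.dfun_H_succ`). When the torsion is `π♯` of a decomposable 3-form `α ∧
β ∧ γ`, the operator under the trace is a sum of three rank-one maps, and half its trace is the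
value at `v` of the covector `C_k = B(β, T^k γ) α + B(γ, T^k α) β + B(α, T^k β) γ`, where `T = N*`
and `B(a, b) = a(π♯ b)` (`trace_pow_sharp_wedge`).

The rest is linear algebra at one point. Put `h_k = dH_{k+1}`, so `h_0 = α` and `h_{k+1} = T h_k -
C_k`. Since `B` is alternating and `T` is `B`-symmetric, every form `B(·, T^k ·)` is alternating.
Unrolling the recursion, the accumulated corrections pair to zero with each of `α, β, γ`, because
they form an antisymmetrised convolution. These pairings make `B(h_{l+1}, h_m) = B(h_l, h_{m+1})`,
so every bracket reduces to `B(α, h_n) = 0` (`isotropic_of_recursion`). -/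

theorem Finset.sum_range_mul_reflect {R : Type*} [CommRing R] (f g : ℕ → R) (n : ℕ) :
    ∑ j ∈ Finset.range n, f j * g (n - 1 - j) = ∑ j ∈ Finset.range n, g j * f (n - 1 - j) := by
  rw [← Finset.sum_range_reflect (fun j => g j * f (n - 1 - j))]
  refine Finset.sum_congr rfl fun j hj => ?_
  have : n - 1 - (n - 1 - j) = j := by have := Finset.mem_range.1 hj; omega
  rw [this, mul_comm]

/-! ### Isotropy of sequences generated by a recursion with cyclic corrections. -/

namespace LinearMap.BilinForm

variable {R D : Type*} [CommRing R] [AddCommGroup D] [Module R D]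
  {B : LinearMap.BilinForm R D} {T : Module.End R D}

theorem apply_pow_comm (hT : ∀ a b, B (T a) b = B a (T b)) (k : ℕ) (a b : D) :
    B ((T ^ k) a) b = B a ((T ^ k) b) := by
  induction k generalizing a b with
  | zero => simp
  | succ k ih => rw [pow_succ, Module.End.mul_apply, ih, hT, ← Module.End.mul_apply,
      (Commute.self_pow T k).eq]

/-- Moving `T ^ k` across `B` keeps the sign while swapping the arguments changes it, so twice the
value is zero. -/
theorem apply_pow_self (hB : B.IsAlt) (h2 : IsUnit (2 : R))
    (hT : ∀ a b, B (T a) b = B a (T b)) (k : ℕ) (a : D) : B a ((T ^ k) a) = 0 := by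
  have h := hB.neg_eq ((T ^ k) a) a
  rw [apply_pow_comm hT] at h
  have : (2 : R) * B a ((T ^ k) a) = 0 := by linear_combination -h
  exact (h2.mul_right_eq_zero).1 this

theorem apply_pow_neg (hB : B.IsAlt) (hT : ∀ a b, B (T a) b = B a (T b)) (k : ℕ) (a b : D) :
    B b ((T ^ k) a) = -B a ((T ^ k) b) := by
  rw [← hB.neg_eq, apply_pow_comm hT]

/-- The correction term `B(b, Tᵏ c) a + B(c, Tᵏ a) b + B(a, Tᵏ b) c`. -/
def cyclicTerm (B : LinearMap.BilinForm R D) (T : Module.End R D) (a b c : D) (k : ℕ) : D :=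
  B b ((T ^ k) c) • a + B c ((T ^ k) a) • b + B a ((T ^ k) b) • c

theorem cyclicTerm_rotate (a b c : D) (k : ℕ) :
    cyclicTerm B T a b c k = cyclicTerm B T b c a k := by
  simp only [cyclicTerm]; abel

/-- The `a`-component of the correction drops out by `apply_pow_self`. The other two give `f * g - g
* f` for the convolution of `f j = B a (T^j b)` and `g j = B c (T^j a)`, which is zero by reflecting
the index. -/
theorem sum_pow_cyclicTerm_apply (hB : B.IsAlt) (h2 : IsUnit (2 : R))
    (hT : ∀ a b, B (T a) b = B a (T b)) (a b c : D) (n : ℕ) :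
    B (∑ j ∈ Finset.range n, (T ^ (n - 1 - j)) (cyclicTerm B T a b c j)) a = 0 := by
  have h := Finset.sum_range_mul_reflect (fun j => B a ((T ^ j) b)) (fun j => B c ((T ^ j) a)) n
  rw [map_sum, LinearMap.sum_apply]
  trans ∑ j ∈ Finset.range n, (B a ((T ^ j) b) * B c ((T ^ (n - 1 - j)) a) -
    B c ((T ^ j) a) * B a ((T ^ (n - 1 - j)) b))
  · refine Finset.sum_congr rfl fun j _ => ?_
    rw [apply_pow_comm hT]
    simp only [cyclicTerm, map_add, map_smul, LinearMap.add_apply, LinearMap.smul_apply,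
      smul_eq_mul, apply_pow_self hB h2 hT]
    rw [apply_pow_neg hB hT _ a b]
    ring
  · rw [Finset.sum_sub_distrib, h, sub_self]

variable {a b c : D} {h : ℕ → D}

theorem eq_pow_sub_sum (h0 : h 0 = a) (hs : ∀ k, h (k + 1) = T (h k) - cyclicTerm B T a b c k)
    (n : ℕ) :
    h n = (T ^ n) a - ∑ j ∈ Finset.range n, (T ^ (n - 1 - j)) (cyclicTerm B T a b c j) := by
  induction n with
  | zero => simp [h0]
  | succ n ih =>
    rw [hs, ih, Finset.sum_range_succ, map_sub, map_sum, pow_succ', Module.End.mul_apply, sub_sub]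
    congr 2
    · refine Finset.sum_congr rfl fun j hj => ?_
      have : n + 1 - 1 - j = n - 1 - j + 1 := by have := Finset.mem_range.1 hj; omega
      rw [this, pow_succ', Module.End.mul_apply]
    · simp

/-- A sequence generated by a `B`-symmetric operator up to cyclic correction terms is isotropic. -/
theorem isotropic_of_recursion (hB : B.IsAlt) (h2 : IsUnit (2 : R))
    (hT : ∀ a b, B (T a) b = B a (T b)) (h0 : h 0 = a)
    (hs : ∀ k, h (k + 1) = T (h k) - cyclicTerm B T a b c k) (l m : ℕ) :
    B (h l) (h m) = 0 := by
  have ha (n : ℕ) : B (h n) a = 0 := by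
    rw [eq_pow_sub_sum h0 hs, map_sub, LinearMap.sub_apply,
      sum_pow_cyclicTerm_apply hB h2 hT, sub_zero, apply_pow_comm hT, apply_pow_self hB h2 hT]
  have hb (n : ℕ) : B (h n) b = B a ((T ^ n) b) := by
    rw [eq_pow_sub_sum h0 hs, map_sub, LinearMap.sub_apply]
    -- Cyclic symmetry puts `b` in the distinguished slot, so the vanishing proved for `a` applies.
    simp only [cyclicTerm_rotate a b c]
    rw [sum_pow_cyclicTerm_apply hB h2 hT, sub_zero, apply_pow_comm hT]
  have hc (n : ℕ) : B (h n) c = -B c ((T ^ n) a) := by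
    rw [eq_pow_sub_sum h0 hs, map_sub, LinearMap.sub_apply]
    simp only [cyclicTerm_rotate a b c, cyclicTerm_rotate b c a]
    rw [sum_pow_cyclicTerm_apply hB h2 hT, sub_zero, apply_pow_comm hT, apply_pow_neg hB hT]
  -- The defect is `B (h m) C_l + B (h l) C_m`. By `ha`, `hb`, `hc` the first summand is
  -- antisymmetric in `l, m`, so the two cancel.
  have hstep (l m : ℕ) : B (h (l + 1)) (h m) = B (h l) (h (m + 1)) := by
    have e : B (cyclicTerm B T a b c l) (h m) = - B (h m) (cyclicTerm B T a b c l) :=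
      (hB.neg_eq _ _).symm
    rw [hs, hs, map_sub, map_sub, LinearMap.sub_apply, hT, e]
    simp only [cyclicTerm, map_add, map_smul, smul_eq_mul, ha, hb, hc]
    ring
  induction l generalizing m with
  | zero => rw [h0, ← hB.neg_eq, ha, neg_zero]
  | succ l ih => rw [hstep, ih]

end LinearMap.BilinForm

/-! ### Derivatives of traces of powers, and the trace against the torsion. -/

section TraceIdentities

variable {E : Type*} [NormedAddCommGroup E] [NormedSpace ℝ E] [FiniteDimensional ℝ E]

/-- The trace as a continuous linear functional on the continuous endomorphisms. -/
noncomputable def ContinuousLinearMap.traceCLM (E : Type*) [NormedAddCommGroup E] [NormedSpace ℝ E]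
    [FiniteDimensional ℝ E] : (E →L[ℝ] E) →L[ℝ] ℝ :=
  LinearMap.toContinuousLinearMap (LinearMap.trace ℝ E ∘ₗ ContinuousLinearMap.coeLM ℝ)

@[simp]
theorem ContinuousLinearMap.traceCLM_apply (A : E →L[ℝ] E) :
    traceCLM E A = LinearMap.trace ℝ E A.toLinearMap := rfl

/-- The noncommutative power rule yields `k + 1` terms with `F'` in different positions; cyclicity
of the trace makes them equal. -/
theorem HasFDerivAt.trace_pow {F : E → E →L[ℝ] E} {F' : E →L[ℝ] E →L[ℝ] E} {y : E}
    (h : HasFDerivAt F F' y) (k : ℕ) :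
    HasFDerivAt (fun z => LinearMap.trace ℝ E ((F z).toLinearMap ^ (k + 1)))
      ((k + 1 : ℝ) • (ContinuousLinearMap.traceCLM E ∘L
        (ContinuousLinearMap.mul ℝ (E →L[ℝ] E) (F y ^ k)) ∘L F')) y := by
  have h1 := (ContinuousLinearMap.traceCLM E).hasFDerivAt.comp y (h.fun_pow' (k + 1))
  refine (h1.congr_fderiv ?_).congr_of_eventuallyEq (.of_forall fun z => ?_)
  · ext v
    simp only [ContinuousLinearMap.comp_apply, sum_apply, map_sum,
      smul_apply, ContinuousLinearMap.mul_apply']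
    trans ∑ i ∈ Finset.range (k + 1), ContinuousLinearMap.traceCLM E (F y ^ k * F' v)
    · refine Finset.sum_congr rfl fun i hi => ?_
      have hik : i + (k - i) = k := by have := Finset.mem_range.1 hi; omega
      simp only [MulOpposite.smul_eq_mul_unop, MulOpposite.unop_op, smul_eq_mul, Nat.pred_succ,
        ContinuousLinearMap.traceCLM_apply, ContinuousLinearMap.toLinearMap_mul]
      rw [LinearMap.trace_mul_comm, ← mul_assoc, ← ContinuousLinearMap.toLinearMap_mul,
        ← pow_add, hik]
    · simp
  · simp [ContinuousLinearMap.toLinearMap_pow]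

omit [FiniteDimensional ℝ E] in
/-- The trace of `A ^ k` times the torsion of a `(1,1)` tensor with value `A` and derivative `D`. -/
theorem LinearMap.trace_pow_mul_torsion (A : E →L[ℝ] E) (D : E →L[ℝ] E →L[ℝ] E) (v : E)
    (τ : E →ₗ[ℝ] E) (hτ : ∀ w, τ w = D (A v) w - D (A w) v - A (D v w - D w v)) (k : ℕ) :
    LinearMap.trace ℝ E (A.toLinearMap ^ k * τ) =
      LinearMap.trace ℝ E (A.toLinearMap ^ k * (D (A v)).toLinearMap) -
        LinearMap.trace ℝ E (A.toLinearMap ^ (k + 1) * (D v).toLinearMap) := by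
  have e : τ = (D (A v)).toLinearMap - (D.flip v).toLinearMap * A.toLinearMap -
      A.toLinearMap * (D v).toLinearMap + A.toLinearMap * (D.flip v).toLinearMap := by
    ext w
    simp [hτ, Module.End.mul_apply]
    abel
  -- The two terms differentiating `N` along `w` cancel by cyclicity; only derivatives along `v` and
  -- `A v` survive.
  have c : LinearMap.trace ℝ E (A.toLinearMap ^ k * ((D.flip v).toLinearMap * A.toLinearMap)) =
      LinearMap.trace ℝ E (A.toLinearMap ^ k * (A.toLinearMap * (D.flip v).toLinearMap)) := by
    rw [← mul_assoc, LinearMap.trace_mul_comm, ← mul_assoc, ← mul_assoc, ← pow_succ, ← pow_succ']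
  rw [e, mul_add, mul_sub, mul_sub, map_add, map_sub, map_sub, c, pow_succ, mul_assoc]
  ring

end TraceIdentities

/-! ### Tensor fields and Lie brackets in a chart. -/

namespace PqN

section Coordinates

variable {E : Type*} [NormedAddCommGroup E] [NormedSpace ℝ E]
  {M : Type*} [TopologicalSpace M] [ChartedSpace E M] [IsManifold 𝓘(ℝ, E) ∞ M]

/-- The expression of a `(1,1)` tensor field in the chart at `x₀`. -/
noncomputable def EndField.inChart (N : EndField E M) (x₀ : M) : E → E →L[ℝ] E := fun y =>
  ContinuousLinearMap.inCoordinates E (TangentSpace 𝓘(ℝ, E)) E (TangentSpace 𝓘(ℝ, E))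
    x₀ ((extChartAt 𝓘(ℝ, E) x₀).symm y) x₀ ((extChartAt 𝓘(ℝ, E) x₀).symm y)
    (N ((extChartAt 𝓘(ℝ, E) x₀).symm y))

theorem EndField.Smooth.differentiableAt_inChart {N : EndField E M} (hN : N.Smooth) (x₀ : M) :
    DifferentiableAt ℝ (N.inChart x₀) (extChartAt 𝓘(ℝ, E) x₀ x₀) := by
  have h1 := ((contMDiffAt_hom_bundle _).1 (hN x₀)).2
  have h2 : ContMDiffAt 𝓘(ℝ, E) 𝓘(ℝ, E) ∞ (extChartAt 𝓘(ℝ, E) x₀).symm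
      (extChartAt 𝓘(ℝ, E) x₀ x₀) :=
    (contMDiffOn_extChartAt_symm x₀).contMDiffAt (extChartAt_target_mem_nhds x₀)
  have h3 : ContMDiffAt 𝓘(ℝ, E) 𝓘(ℝ, E →L[ℝ] E) ∞ (N.inChart x₀) (extChartAt 𝓘(ℝ, E) x₀ x₀) := by
    refine ContMDiffAt.comp (x := extChartAt 𝓘(ℝ, E) x₀ x₀) (I' := 𝓘(ℝ, E))
      (g := fun x => ContinuousLinearMap.inCoordinates E (TangentSpace 𝓘(ℝ, E)) E
        (TangentSpace 𝓘(ℝ, E)) x₀ x x₀ x (N x)) (f := (extChartAt 𝓘(ℝ, E) x₀).symm) ?_ h2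
    rw [extChartAt_to_inv]
    exact h1
  exact h3.contDiffAt.differentiableAt (by simp)

/-- The torsion condition concerns globally defined smooth fields; a bump function extends
coordinate-constant fields to all of `M`. -/
theorem exists_smooth_eventuallyEq_symmL [FiniteDimensional ℝ E] [T2Space M] (x₀ : M) (v : E) :
    ∃ X : VField E M, X.Smooth ∧ ∀ᶠ x in nhds x₀,
      X x = (trivializationAt E (TangentSpace 𝓘(ℝ, E)) x₀).symmL ℝ x v := by
  let e := trivializationAt E (TangentSpace 𝓘(ℝ, E) : M → Type _) x₀
  obtain ⟨ψ⟩ : Nonempty (SmoothBumpFunction 𝓘(ℝ, E) x₀) := inferInstance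
  refine ⟨(ψ : M → ℝ) • fun x => e.symmL ℝ x v, ?_, ?_⟩
  · refine ContMDiffOn.smul_section_of_tsupport (u := e.baseSet) (V := TangentSpace 𝓘(ℝ, E))
      ψ.contMDiff.contMDiffOn e.open_baseSet ?_ ?_
    · exact ψ.tsupport_subset_chartAt_source
    · rw [e.contMDiffOn_section_baseSet_iff]
      refine (contMDiffOn_const (c := v)).congr fun y hy => ?_
      simp [hy]
  · filter_upwards [ψ.eventuallyEq_one] with x hx
    simp [hx, e]

/-- The preferred chart at `x₀` has identity derivative there, so the coordinate bracket needs no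
transport back. -/
theorem mlieBracket_eq_lieBracket {x₀ : M} {V W : VField E M} {v w : E → E}
    (hV : ∀ᶠ y in nhds (extChartAt 𝓘(ℝ, E) x₀ x₀),
      (trivializationAt E (TangentSpace 𝓘(ℝ, E)) x₀).continuousLinearMapAt ℝ
        ((extChartAt 𝓘(ℝ, E) x₀).symm y) (V ((extChartAt 𝓘(ℝ, E) x₀).symm y)) = v y)
    (hW : ∀ᶠ y in nhds (extChartAt 𝓘(ℝ, E) x₀ x₀),
      (trivializationAt E (TangentSpace 𝓘(ℝ, E)) x₀).continuousLinearMapAt ℝ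
        ((extChartAt 𝓘(ℝ, E) x₀).symm y) (W ((extChartAt 𝓘(ℝ, E) x₀).symm y)) = w y) :
    VectorField.mlieBracket 𝓘(ℝ, E) V W x₀ =
      (VectorField.lieBracket ℝ v w (extChartAt 𝓘(ℝ, E) x₀ x₀) : E) := by
  have key : ∀ {V : VField E M} {v : E → E}, (∀ᶠ y in nhds (extChartAt 𝓘(ℝ, E) x₀ x₀),
      (trivializationAt E (TangentSpace 𝓘(ℝ, E)) x₀).continuousLinearMapAt ℝ
        ((extChartAt 𝓘(ℝ, E) x₀).symm y) (V ((extChartAt 𝓘(ℝ, E) x₀).symm y)) = v y) →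
      (VectorField.mpullbackWithin 𝓘(ℝ, E) 𝓘(ℝ, E) (extChartAt 𝓘(ℝ, E) x₀).symm V
        (Set.range 𝓘(ℝ, E))) =ᶠ[nhds (extChartAt 𝓘(ℝ, E) x₀ x₀)] v := by
    intro V v h
    filter_upwards [h, extChartAt_target_mem_nhds (I := 𝓘(ℝ, E)) x₀] with y hy hyt
    have hs : (extChartAt 𝓘(ℝ, E) x₀).symm y ∈ (chartAt E x₀).source := by
      simpa using (extChartAt 𝓘(ℝ, E) x₀).map_target hyt
    rw [← hy, VectorField.mpullbackWithin_apply,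
      TangentBundle.continuousLinearMapAt_trivializationAt hs]
    congr 1
    exact ContinuousLinearMap.inverse_eq
      (mfderivWithin_extChartAt_symm_comp_mfderiv_extChartAt hyt)
      (mfderiv_extChartAt_comp_mfderivWithin_extChartAt_symm hyt)
  have hinv : (mfderiv 𝓘(ℝ, E) 𝓘(ℝ, E) (extChartAt 𝓘(ℝ, E) x₀) x₀).inverse =
      ContinuousLinearMap.id ℝ E := by
    rw [mfderiv_extChartAt_self]
    exact ContinuousLinearMap.inverse_id
  have hset : (extChartAt 𝓘(ℝ, E) x₀).symm ⁻¹' Set.univ ∩ Set.range 𝓘(ℝ, E) = Set.univ := by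
    simp
  refine (DFunLike.congr_fun hinv _).trans ?_
  rw [hset]
  exact (congrFun (VectorField.lieBracketWithin_univ (𝕜 := ℝ) (E := E)) _).trans
    ((key hV).lieBracket_vectorField_eq (key hW))

end Coordinates

end PqN

/-! ### The torsion in coordinates and the recursion for the differentials of the traces. -/

namespace PqN

section Torsion

variable {E : Type*} [NormedAddCommGroup E] [NormedSpace ℝ E]
  {M : Type*} [TopologicalSpace M] [ChartedSpace E M] [IsManifold 𝓘(ℝ, E) ∞ M]

theorem continuousLinearMapAt_self (x₀ : M) :
    (trivializationAt E (TangentSpace 𝓘(ℝ, E)) x₀).continuousLinearMapAt ℝ x₀ =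
      ContinuousLinearMap.id ℝ E := by
  rw [TangentBundle.continuousLinearMapAt_trivializationAt (mem_chart_source E x₀)]
  exact mfderiv_extChartAt_self

theorem symmL_self (x₀ : M) :
    (trivializationAt E (TangentSpace 𝓘(ℝ, E)) x₀).symmL ℝ x₀ = ContinuousLinearMap.id ℝ E := by
  ext v
  have h := (trivializationAt E (TangentSpace 𝓘(ℝ, E)) x₀).continuousLinearMapAt_symmL (R := ℝ)
    (FiberBundle.mem_baseSet_trivializationAt' x₀) v
  rw [continuousLinearMapAt_self] at h
  exact h

theorem EndField.inChart_self (N : EndField E M) (x₀ : M) :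
    N.inChart x₀ (extChartAt 𝓘(ℝ, E) x₀ x₀) = (N x₀ : E →L[ℝ] E) := by
  rw [EndField.inChart, extChartAt_to_inv, ContinuousLinearMap.inCoordinates,
    continuousLinearMapAt_self, symmL_self]
  rfl

omit [IsManifold 𝓘(ℝ, E) ∞ M] in
theorem eventually_extChartAt_symm {x₀ : M} {p : M → Prop} (h : ∀ᶠ x in nhds x₀, p x) :
    ∀ᶠ y in nhds (extChartAt 𝓘(ℝ, E) x₀ x₀), p ((extChartAt 𝓘(ℝ, E) x₀).symm y) := by
  have := continuousAt_extChartAt_symm (I := 𝓘(ℝ, E)) x₀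
  rw [ContinuousAt, extChartAt_to_inv] at this
  exact this.eventually h

/-- For coordinate-constant fields `[X, Y]` vanishes at `x₀`, and the other brackets only
differentiate `N`. -/
theorem EndField.torsion_eq_fderiv {N : EndField E M} (hN : N.Smooth) {x₀ : M}
    {X Y : VField E M} {v w : E}
    (hX : ∀ᶠ x in nhds x₀, X x = (trivializationAt E (TangentSpace 𝓘(ℝ, E)) x₀).symmL ℝ x v)
    (hY : ∀ᶠ x in nhds x₀, Y x = (trivializationAt E (TangentSpace 𝓘(ℝ, E)) x₀).symmL ℝ x w)
    {A : E →L[ℝ] E} (hA : A = N.inChart x₀ (extChartAt 𝓘(ℝ, E) x₀ x₀))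
    {D : E →L[ℝ] E →L[ℝ] E} (hD : D = fderiv ℝ (N.inChart x₀) (extChartAt 𝓘(ℝ, E) x₀ x₀)) :
    N.torsion X Y x₀ = (D (A v) w - D (A w) v - A (D v w - D w v) : E) := by
  have hbase : ∀ᶠ x in nhds x₀, x ∈ (trivializationAt E (TangentSpace 𝓘(ℝ, E)) x₀).baseSet :=
    (trivializationAt E (TangentSpace 𝓘(ℝ, E)) x₀).open_baseSet.mem_nhds
      (FiberBundle.mem_baseSet_trivializationAt' x₀)
  have hc : ∀ {X : VField E M} {v : E},
      (∀ᶠ x in nhds x₀, X x = (trivializationAt E (TangentSpace 𝓘(ℝ, E)) x₀).symmL ℝ x v) →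
      ∀ᶠ y in nhds (extChartAt 𝓘(ℝ, E) x₀ x₀),
      (trivializationAt E (TangentSpace 𝓘(ℝ, E)) x₀).continuousLinearMapAt ℝ
        ((extChartAt 𝓘(ℝ, E) x₀).symm y) (X ((extChartAt 𝓘(ℝ, E) x₀).symm y)) = v := by
    intro X v h
    filter_upwards [eventually_extChartAt_symm (h.and hbase)] with y hy
    rw [hy.1, Bundle.Trivialization.continuousLinearMapAt_symmL _ hy.2]
  have hn : ∀ {X : VField E M} {v : E},
      (∀ᶠ x in nhds x₀, X x = (trivializationAt E (TangentSpace 𝓘(ℝ, E)) x₀).symmL ℝ x v) →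
      ∀ᶠ y in nhds (extChartAt 𝓘(ℝ, E) x₀ x₀),
      (trivializationAt E (TangentSpace 𝓘(ℝ, E)) x₀).continuousLinearMapAt ℝ
        ((extChartAt 𝓘(ℝ, E) x₀).symm y) (N.app X ((extChartAt 𝓘(ℝ, E) x₀).symm y)) =
        N.inChart x₀ y v := by
    intro X v h
    filter_upwards [eventually_extChartAt_symm h] with y hy
    rw [EndField.app, hy]
    rfl
  have hf : ∀ v : E, fderiv ℝ (fun y => N.inChart x₀ y v) (extChartAt 𝓘(ℝ, E) x₀ x₀) =
      D.flip v := by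
    intro v
    have := ((hN.differentiableAt_inChart x₀).hasFDerivAt.clm_apply
      (hasFDerivAt_const v (extChartAt 𝓘(ℝ, E) x₀ x₀))).fderiv
    rw [this, hD]
    ext u
    simp
  have hA' : A = @id (E →L[ℝ] E) (N x₀) := hA.trans (N.inChart_self x₀)
  rw [EndField.torsion, mlieBracket_eq_lieBracket (hn hX) (hn hY),
    mlieBracket_eq_lieBracket (hn hX) (hc hY), mlieBracket_eq_lieBracket (hc hX) (hn hY),
    mlieBracket_eq_lieBracket (hc hX) (hc hY)]
  simp only [VectorField.lieBracket, hf, fderiv_fun_const, ← hA]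
  change D.flip w (A v) - D.flip v (A w) - @id (E →L[ℝ] E) (N x₀)
    ((0 : E →L[ℝ] E) (A v) - D.flip v w + (D.flip w v - (0 : E →L[ℝ] E) (A w)) -
      @id (E →L[ℝ] E) (N x₀) ((0 : E →L[ℝ] E) v - (0 : E →L[ℝ] E) w)) = _
  rw [← hA']
  simp only [ContinuousLinearMap.flip_apply, zero_apply, sub_zero, zero_sub, map_zero]
  congr 2
  abel

variable [FiniteDimensional ℝ E]

omit [FiniteDimensional ℝ E] in
theorem EndField.trace_inChart (N : EndField E M) {x₀ x : M}
    (hx : x ∈ (extChartAt 𝓘(ℝ, E) x₀).source) (k : ℕ) :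
    LinearMap.trace ℝ E ((N.inChart x₀ (extChartAt 𝓘(ℝ, E) x₀ x)).toLinearMap ^ k) =
      LinearMap.trace ℝ (TangentSpace 𝓘(ℝ, E) x) ((N x).toLinearMap ^ k) := by
  have hb : x ∈ (trivializationAt E (TangentSpace 𝓘(ℝ, E)) x₀).baseSet := by
    simpa using hx
  rw [EndField.inChart, (extChartAt 𝓘(ℝ, E) x₀).left_inv hx,
    ContinuousLinearMap.inCoordinates_eq hb hb]
  let ε : TangentSpace 𝓘(ℝ, E) x ≃ₗ[ℝ] E :=
    ((trivializationAt E (TangentSpace 𝓘(ℝ, E)) x₀).continuousLinearEquivAt ℝ x hb).toLinearEquiv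
  have := LinearMap.trace_conj' ((N x).toLinearMap ^ k) ε
  rw [← this]
  exact congrArg _ (map_pow ε.conjRingEquiv (N x).toLinearMap k).symm

theorem EndField.Smooth.dfun_H {N : EndField E M} (hN : N.Smooth) (x₀ : M) (k : ℕ) (v : E)
    {A : E →L[ℝ] E} (hA : A = N.inChart x₀ (extChartAt 𝓘(ℝ, E) x₀ x₀))
    {D : E →L[ℝ] E →L[ℝ] E} (hD : D = fderiv ℝ (N.inChart x₀) (extChartAt 𝓘(ℝ, E) x₀ x₀)) :
    dfun (E := E) (N.H (k + 1)) x₀ v =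
      1 / 2 * LinearMap.trace ℝ E (A.toLinearMap ^ k * (D v).toLinearMap) := by
  have h1 := ((hN.differentiableAt_inChart x₀).hasFDerivAt.trace_pow k).const_mul
    (1 / (2 * ((k + 1 : ℕ) : ℝ)))
  have h2 : HasMFDerivAt 𝓘(ℝ, E) 𝓘(ℝ, E) (extChartAt 𝓘(ℝ, E) x₀) x₀
      (ContinuousLinearMap.id ℝ E) := by
    have := (mdifferentiableAt_extChartAt (I := 𝓘(ℝ, E)) (mem_chart_source E x₀)).hasMFDerivAt
    rwa [mfderiv_extChartAt_self] at this
  have h3 := (h1.hasMFDerivAt.comp x₀ h2).congr_of_eventuallyEq (f₁ := N.H (k + 1)) (by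
    filter_upwards [extChartAt_source_mem_nhds (I := 𝓘(ℝ, E)) x₀] with x hx
    rw [Function.comp_apply, N.trace_inChart hx]
    rfl)
  have h4 := h3.mfderiv
  rw [dfun, mvfderiv, h4, ← hA, ← hD]
  change 1 / (2 * ((k + 1 : ℕ) : ℝ)) * ((k + 1 : ℝ) *
    LinearMap.trace ℝ E (A ^ k * D v).toLinearMap) = _
  rw [ContinuousLinearMap.toLinearMap_mul, ContinuousLinearMap.toLinearMap_pow]
  push_cast
  field_simp

/-- The normalisation `1 / (2k)` makes each `dH_{k+1}` equal to `½ Tr(A^k D v)`, so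
`trace_pow_mul_torsion` becomes a recursion with no `k`-dependent coefficients. -/
theorem EndField.Smooth.dfun_H_succ [T2Space M] {N : EndField E M} (hN : N.Smooth) (x₀ : M)
    (τ : TangentSpace 𝓘(ℝ, E) x₀ → TangentSpace 𝓘(ℝ, E) x₀ →ₗ[ℝ] TangentSpace 𝓘(ℝ, E) x₀)
    (hτ : ∀ X Y : VField E M, X.Smooth → Y.Smooth → N.torsion X Y x₀ = τ (X x₀) (Y x₀)) (k : ℕ)
    (v : TangentSpace 𝓘(ℝ, E) x₀) :
    dfun (E := E) (N.H (k + 2)) x₀ v = dfun (E := E) (N.H (k + 1)) x₀ (N x₀ v) -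
      1 / 2 * LinearMap.trace ℝ (TangentSpace 𝓘(ℝ, E) x₀) ((N x₀).toLinearMap ^ k * τ v) := by
  have hA := N.inChart_self x₀
  generalize hA' : N.inChart x₀ (extChartAt 𝓘(ℝ, E) x₀ x₀) = A at hA
  generalize hD : fderiv ℝ (N.inChart x₀) (extChartAt 𝓘(ℝ, E) x₀ x₀) = D
  have h := LinearMap.trace_pow_mul_torsion A D v (τ v) (fun w => by
    obtain ⟨X, hXs, hX⟩ := exists_smooth_eventuallyEq_symmL (E := E) x₀ v
    obtain ⟨Y, hYs, hY⟩ := exists_smooth_eventuallyEq_symmL (E := E) x₀ w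
    have h1 := hτ X Y hXs hYs
    rw [EndField.torsion_eq_fderiv hN hX hY hA'.symm hD.symm, hX.self_of_nhds, hY.self_of_nhds,
      symmL_self] at h1
    exact h1.symm) k
  have h1 := hN.dfun_H x₀ (k + 1) v hA'.symm hD.symm
  have h2 := hN.dfun_H x₀ k (A v) hA'.symm hD.symm
  rw [hA] at h h1 h2
  refine h1.trans ?_
  refine Eq.trans ?_ (congrArg₂ (fun s t : ℝ => s - 1 / 2 * t) h2.symm h.symm)
  ring

end Torsion

end PqN

/-! ### Linear algebra at a point: the trace for a decomposable 3-form. -/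

namespace PqN

section LinearAlgebra

variable {V : Type*} [AddCommGroup V] [Module ℝ V] [TopologicalSpace V]

/-- The bilinear form `(a, b) ↦ a (P b)` on covectors. -/
noncomputable def sharpForm (P : (V →L[ℝ] ℝ) →L[ℝ] V) : LinearMap.BilinForm ℝ (V →L[ℝ] ℝ) :=
  LinearMap.mk₂ ℝ (fun a b => a (P b)) (by simp) (by simp) (by simp) (by simp)

theorem sharpForm_isAlt {P : (V →L[ℝ] ℝ) →L[ℝ] V}
    (hP : ∀ a b : V →L[ℝ] ℝ, b (P a) = -a (P b)) : (sharpForm P).IsAlt := fun a => by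
  have := hP a a
  change a (P a) = 0
  linarith

/-- The transpose of an endomorphism, acting on covectors. -/
def transposeEnd (A : V →L[ℝ] V) : Module.End ℝ (V →L[ℝ] ℝ) where
  toFun a := a.comp A
  map_add' _ _ := rfl
  map_smul' _ _ := rfl

theorem transposeEnd_pow_apply (A : V →L[ℝ] V) (k : ℕ) (a : V →L[ℝ] ℝ) (v : V) :
    (transposeEnd A ^ k) a v = a ((A.toLinearMap ^ k) v) := by
  induction k generalizing a v with
  | zero => simp
  | succ k ih => rw [pow_succ, Module.End.mul_apply, ih, pow_succ']; rfl

theorem sharp_transposeEnd_pow {A : V →L[ℝ] V} {P : (V →L[ℝ] ℝ) →L[ℝ] V}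
    (hAP : ∀ a, A (P a) = P (a.comp A)) (k : ℕ) (a : V →L[ℝ] ℝ) :
    P ((transposeEnd A ^ k) a) = (A.toLinearMap ^ k) (P a) := by
  induction k generalizing a with
  | zero => simp
  | succ k ih =>
    rw [pow_succ, Module.End.mul_apply, ih, pow_succ, Module.End.mul_apply]
    exact congrArg _ (hAP a).symm

/-- Expanding the determinant along `w` shows three rank-one operators, whose traces are
evaluations. The six terms agree in pairs by skewness of `B(·, T^k ·)`; hence the factor 2, which
the `½` in the recursion absorbs. -/
theorem trace_pow_sharp_wedge [Module.Finite ℝ V] {A : V →L[ℝ] V} {P : (V →L[ℝ] ℝ) →L[ℝ] V}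
    (hP : ∀ a b : V →L[ℝ] ℝ, b (P a) = -a (P b)) (hAP : ∀ a, A (P a) = P (a.comp A))
    (a b c : V →L[ℝ] ℝ) (k : ℕ) (v : V) (τ : V →ₗ[ℝ] V)
    (hτ : ∀ w, τ w = P ((wedgeCovectors a b c).toContinuousLinearMap ![v, w, 0] 2)) :
    LinearMap.trace ℝ V (A.toLinearMap ^ k * τ) =
      2 * LinearMap.BilinForm.cyclicTerm (sharpForm P) (transposeEnd A) a b c k v := by
  have hB := sharpForm_isAlt hP
  have hT : ∀ x y, sharpForm P (transposeEnd A x) y = sharpForm P x (transposeEnd A y) :=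
    fun x y => congrArg x (hAP y)
  have hk (x y : V →L[ℝ] ℝ) :
      x ((A.toLinearMap ^ k) (P y)) = sharpForm P x ((transposeEnd A ^ k) y) :=
    congrArg x (sharp_transposeEnd_pow hAP k y).symm
  have e : A.toLinearMap ^ k * τ =
      b.toLinearMap.smulRight ((A.toLinearMap ^ k) (P (a v • c - c v • a))) +
      c.toLinearMap.smulRight ((A.toLinearMap ^ k) (P (b v • a - a v • b))) +
      a.toLinearMap.smulRight ((A.toLinearMap ^ k) (P (c v • b - b v • c))) := by
    ext w
    have h : (wedgeCovectors a b c).toContinuousLinearMap ![v, w, 0] 2 =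
        b w • (a v • c - c v • a) + c w • (b v • a - a v • b) + a w • (c v • b - b v • c) := by
      ext z
      have hz : Function.update ![v, w, 0] 2 z = ![v, w, z] := by
        ext i; fin_cases i <;> simp
      change wedgeCovectors a b c (Function.update ![v, w, 0] 2 z) = _
      rw [hz]
      change Matrix.det (Matrix.of fun i j : Fin 3 =>
        (![a.toLinearMap, b.toLinearMap, c.toLinearMap] j) (![v, w, z] i)) = _
      rw [Matrix.det_fin_three]
      simp
      ring
    rw [Module.End.mul_apply, hτ, h]
    simp only [map_add, map_smul, LinearMap.add_apply, LinearMap.smulRight_apply,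
      ContinuousLinearMap.coe_coe]
  rw [e, map_add, map_add, LinearMap.trace_smulRight, LinearMap.trace_smulRight,
    LinearMap.trace_smulRight]
  simp only [map_sub, map_smul, ContinuousLinearMap.coe_coe, smul_eq_mul, hk,
    LinearMap.BilinForm.cyclicTerm, add_apply, smul_apply]
  rw [LinearMap.BilinForm.apply_pow_neg hB hT k b c, LinearMap.BilinForm.apply_pow_neg hB hT k c a,
    LinearMap.BilinForm.apply_pow_neg hB hT k a b]
  ring

end LinearAlgebra

end PqN

/-! ### Involutivity. -/

theorem mainTheorem1
    {E : Type*} [NormedAddCommGroup E] [NormedSpace ℝ E] [FiniteDimensional ℝ E]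
    {M : Type*} [TopologicalSpace M] [T2Space M] [ChartedSpace E M] [IsManifold 𝓘(ℝ, E) ∞ M]
    (P : PqN.SharpField E M) (N : PqN.EndField E M) (φ : PqN.Form E M 3)
    (hPqN : PqN.IsPoissonQuasiNijenhuis P N φ)
    (α β γ : PqN.OneForm E M) (hβ : β.Smooth) (hγ : γ.Smooth)
    (hα : α = PqN.dfun (N.H 1)) (hφ : φ = PqN.OneForm.wedge₃ α β γ) :
    ∀ l m : ℕ, 1 ≤ l → 1 ≤ m → ∀ x : M, P.bracket (N.H l) (N.H m) x = 0 := by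
  intro l m hl hm x
  obtain ⟨l, rfl⟩ := Nat.exists_eq_add_of_le' hl
  obtain ⟨m, rfl⟩ := Nat.exists_eq_add_of_le' hm
  have : Module.Finite ℝ (TangentSpace 𝓘(ℝ, E) x) := inferInstanceAs (Module.Finite ℝ E)
  have hskew := hPqN.poisson.skew x
  have hcomm := hPqN.compatible.comm x
  let τ (v : TangentSpace 𝓘(ℝ, E) x) : TangentSpace 𝓘(ℝ, E) x →ₗ[ℝ] TangentSpace 𝓘(ℝ, E) x :=
    { toFun := fun w => P x ((φ x).toContinuousLinearMap ![v, w, 0] 2)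
      map_add' := fun w w' => by
        rw [← map_add]
        refine congrArg _ (ContinuousLinearMap.ext fun z => ?_)
        have h (u : TangentSpace 𝓘(ℝ, E) x) : Function.update ![v, u, 0] 2 z =
            Function.update ![v, 0, z] 1 u := by
          ext i; fin_cases i <;> simp
        change φ x (Function.update _ 2 z) =
          φ x (Function.update _ 2 z) + φ x (Function.update _ 2 z)
        simp only [h, ContinuousAlternatingMap.map_update_add]
      map_smul' := fun r w => by
        rw [RingHom.id_apply, ← map_smul]
        refine congrArg _ (ContinuousLinearMap.ext fun z => ?_)
        have h (u : TangentSpace 𝓘(ℝ, E) x) : Function.update ![v, u, 0] 2 z =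
            Function.update ![v, 0, z] 1 u := by
          ext i; fin_cases i <;> simp
        change φ x (Function.update _ 2 z) = r • φ x (Function.update _ 2 z)
        simp only [h, ContinuousAlternatingMap.map_update_smul] }
  -- The indices enter as `m l` because `{f, g} = dg(π♯ df)` is `B(dg, df)`; the shift by one starts
  -- the sequence at `dH_1 = α`.
  refine LinearMap.BilinForm.isotropic_of_recursion (B := PqN.sharpForm (P x))
    (T := PqN.transposeEnd (N x)) (a := α x) (b := β x) (c := γ x)
    (h := fun k => PqN.dfun (N.H (k + 1)) x) (PqN.sharpForm_isAlt hskew) (by norm_num)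
    (fun a b => congrArg a (hcomm b)) (by rw [hα]) (fun k => ?_) m l
  ext v
  have h1 := hPqN.smooth_N.dfun_H_succ x τ (fun X Y hX hY => hPqN.torsion_eq X Y hX hY x) k v
  have h2 := PqN.trace_pow_sharp_wedge hskew hcomm (α x) (β x) (γ x) k v (τ v)
    (fun w => by subst hφ; rfl)
  rw [h2] at h1
  refine h1.trans ?_
  change _ = PqN.dfun (N.H (k + 1)) x (N x v) -
    LinearMap.BilinForm.cyclicTerm (PqN.sharpForm (P x)) (PqN.transposeEnd (N x)) _ _ _ k v
  ring
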